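/- Let $A$ be a stable matching instance on a finite set of boys and a finite set of girls, with possibly incomplete preference lists: every agent strictly ranks a subset of the agents of the other sex, where $g$ is on $b$'s list if and only if $b$ is on $g$'s list, and prefers every agent on its list to being unmatched. A matching of listed (mutually acceptable) pairs is stable for an instance if no boy and girl who are on each other's lists strictly prefer each other to their situations (partner, or being unmatched) in the matching. Let $\mathcal{L}_A$ be the lattice of stable matchings of $A$ ordered by dominance ($M \preceq M'$ if every boy weakly prefers his situation in $M$ to that in $M'$); in the meet $M\wedge M'$ every boy gets the one of his two situations that he prefers, and in the join $M\vee M'$ the one that he likes less. An upward shift of $A$ replaces the list $(\ldots, x_1, \ldots, x_k, x, \ldots)$ of one single agent by $(\ldots, x, x_1, \ldots, x_k, \ldots)$ for some $k \ge 0$ ($k=0$ means that no error occurs) and leaves all other lists unchanged. Let $D$ be the set of all instances obtained from $A$ by an upward shift in the list of a boy or of a girl, let $p$ be a discrete probability distribution on $D$, and let $B$ be drawn from $p$. A stable matching $M$ of $A$ is called robust if it maximizes $\Pr_p[M \text{ is stable for } B]$ among all stable matchings of $A$. Lemma. For every such $A$ and $p$, the set of robust stable matchings of $A$ is a sublattice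 of $\mathcal{L}_A$, that is, if $M_1$ and $M_2$ are robust, then so are $M_1\wedge M_2$ and $M_1\vee M_2$. -/

import Mathlib

/-- A stable matching instance, with possibly incomplete lists: every agent strictly ranks its
acceptable partners (its neighbours in the bipartite graph) in a list, most preferred first. -/
structure SMInstance (Boy Girl : Type*) where
  boyList : Boy → List Girl
  girlList : Girl → List Boy
  boyList_nodup : ∀ b, (boyList b).Nodup
  girlList_nodup : ∀ g, (girlList g).Nodup
  mem_boyList_iff : ∀ b g, g ∈ boyList b ↔ b ∈ girlList g

/-- The position of an outcome in a preference list; smaller means more preferred. Being unmatched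
(`none`) comes after all the entries of the list. -/
def prefRank {α : Type*} [DecidableEq α] (l : List α) : Option α → ℕ
  | some x => l.idxOf x
  | none => l.length

namespace SMInstance

variable {Boy Girl : Type*} [DecidableEq Boy] [DecidableEq Girl]

/-- The pair `b`, `g` blocks `M`: they are acceptable to each other and each of them strictly
prefers the other to its situation under `M` (a partner, or being unmatched). -/
def Blocks (A : SMInstance Boy Girl) (M : Boy ≃. Girl) (b : Boy) (g : Girl) : Prop :=
  g ∈ A.boyList b ∧
    prefRank (A.boyList b) (some g) < prefRank (A.boyList b) (M b) ∧
    prefRank (A.girlList g) (some b) < prefRank (A.girlList g) (M.symm g)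

/-- `M` is a stable matching of `A`: it uses only acceptable pairs and has no blocking pair. -/
def IsStable (A : SMInstance Boy Girl) (M : Boy ≃. Girl) : Prop :=
  (∀ b g, M b = some g → g ∈ A.boyList b) ∧ ∀ b g, ¬ A.Blocks M b g

end SMInstance

/-- The list `l'` arises from `l` by moving one entry `x` up, above the `k ≥ 0` entries `seg`
immediately before it (`k = 0` leaves the list unchanged). -/
def IsUpwardShiftOfList {α : Type*} (l l' : List α) : Prop :=
  ∃ (pre seg : List α) (x : α) (post : List α),
    l = pre ++ seg ++ x :: post ∧ l' = pre ++ x :: seg ++ post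

namespace SMInstance

/-- `B` is obtained from `A` by an upward shift in the list of a single girl or a single boy. -/
def IsUpwardShift {Boy Girl : Type*} (A B : SMInstance Boy Girl) : Prop :=
  (∃ g, IsUpwardShiftOfList (A.girlList g) (B.girlList g) ∧
      (∀ g', g' ≠ g → B.girlList g' = A.girlList g') ∧ B.boyList = A.boyList) ∨
  (∃ b, IsUpwardShiftOfList (A.boyList b) (B.boyList b) ∧
      (∀ b', b' ≠ b → B.boyList b' = A.boyList b') ∧ B.girlList = A.girlList)

/-- The domain of errors: the instances that result from `A` by an upward shift. -/
def ShiftDomain {Boy Girl : Type*} (A : SMInstance Boy Girl) : Type _ :=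
  {B : SMInstance Boy Girl // A.IsUpwardShift B}

/-! ### Facts needed for the lattice of stable matchings -/

/-- Exchange of the roles of boys and girls. -/
def swap {Boy Girl : Type*} (A : SMInstance Boy Girl) : SMInstance Girl Boy where
  boyList := A.girlList
  girlList := A.boyList
  boyList_nodup := A.girlList_nodup
  girlList_nodup := A.boyList_nodup
  mem_boyList_iff := fun g b => (A.mem_boyList_iff b g).symm

variable {Boy Girl : Type*} [DecidableEq Boy] [DecidableEq Girl]

theorem IsStable.swap {A : SMInstance Boy Girl} {M : Boy ≃. Girl} (h : A.IsStable M) :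
    A.swap.IsStable M.symm := by
  refine ⟨fun g b hgb => ?_, fun g b hB => h.2 b g ⟨?_, hB.2.2, hB.2.1⟩⟩
  · exact (A.mem_boyList_iff b g).1 (h.1 b g ((M.mem_iff_mem).1 hgb))
  · exact (A.mem_boyList_iff b g).2 hB.1

theorem prefRank_inj {α : Type*} [DecidableEq α] {l : List α} {x y : Option α}
    (hx : ∀ a, x = some a → a ∈ l) (hy : ∀ a, y = some a → a ∈ l)
    (h : prefRank l x = prefRank l y) : x = y := by
  rcases x with _ | a <;> rcases y with _ | b
  · rfl
  · have := List.idxOf_lt_length_of_mem (hy b rfl)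
    simp only [prefRank] at h
    omega
  · have := List.idxOf_lt_length_of_mem (hx a rfl)
    simp only [prefRank] at h
    omega
  · simp only [prefRank] at h
    rw [(List.idxOf_inj (hx a rfl)).1 h]

theorem IsStable.eq_of_rank {A : SMInstance Boy Girl} {M N : Boy ≃. Girl} (hM : A.IsStable M)
    (hN : A.IsStable N) {b : Boy}
    (h : prefRank (A.boyList b) (M b) = prefRank (A.boyList b) (N b)) : M b = N b :=
  prefRank_inj (hM.1 b) (hN.1 b) h

/-- If `b` gets `g` in `M` and strictly prefers this to `N`, then `g` strictly prefers `N`. -/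
theorem IsStable.girl_lt {A : SMInstance Boy Girl} {M N : Boy ≃. Girl} (hM : A.IsStable M)
    (hN : A.IsStable N) {b : Boy} {g : Girl} (hbg : M b = some g)
    (h : prefRank (A.boyList b) (M b) < prefRank (A.boyList b) (N b)) :
    prefRank (A.girlList g) (N.symm g) < prefRank (A.girlList g) (M.symm g) := by
  have hg : M.symm g = some b := M.eq_some_iff.2 hbg
  rw [hbg] at h
  have h1 : ¬ prefRank (A.girlList g) (some b) < prefRank (A.girlList g) (N.symm g) :=
    fun h2 => hN.2 b g ⟨hM.1 b g hbg, h, h2⟩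
  rw [hg]
  refine lt_of_le_of_ne (not_lt.1 h1) fun h2 => ?_
  have h3 : N.symm g = M.symm g := hN.swap.eq_of_rank hM.swap (by rw [hg]; exact h2)
  rw [hg] at h3
  rw [N.eq_some_iff.1 h3] at h
  exact lt_irrefl _ h

/-- If `g` gets `b` in `M` and strictly prefers `N`, then `b` strictly prefers `M`. -/
theorem IsStable.boy_lt [Finite Girl] {A : SMInstance Boy Girl} {M N : Boy ≃. Girl}
    (hM : A.IsStable M) (hN : A.IsStable N) {b : Boy} {g : Girl} (hbg : M b = some g)
    (h : prefRank (A.girlList g) (N.symm g) < prefRank (A.girlList g) (M.symm g)) :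
    prefRank (A.boyList b) (M b) < prefRank (A.boyList b) (N b) := by
  let X := {b : Boy // prefRank (A.boyList b) (M b) < prefRank (A.boyList b) (N b)}
  let Y := {g : Girl //
    prefRank (A.girlList g) (N.symm g) < prefRank (A.girlList g) (M.symm g)}
  have hX : ∀ x : X, ∃ y : Y, M x.1 = some y.1 := by
    rintro ⟨x, hx⟩
    cases hMx : M x with
    | none =>
      exfalso
      rw [hMx] at hx
      cases hNx : N x with
      | none => rw [hNx] at hx; exact lt_irrefl _ hx
      | some y =>
        have := List.idxOf_lt_length_of_mem (hN.1 x y hNx)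
        rw [hNx] at hx
        simp only [prefRank] at hx
        omega
    | some y => exact ⟨⟨y, hM.girl_lt hN hMx hx⟩, rfl⟩
  have hY : ∀ y : Y, ∃ x : X, N.symm y.1 = some x.1 := by
    rintro ⟨y, hy⟩
    cases hNy : N.symm y with
    | none =>
      exfalso
      rw [hNy] at hy
      cases hMy : M.symm y with
      | none => rw [hMy] at hy; exact lt_irrefl _ hy
      | some x =>
        have hxy : x ∈ A.girlList y := hM.swap.1 y x hMy
        have := List.idxOf_lt_length_of_mem hxy
        rw [hMy] at hy
        simp only [prefRank] at hy
        omega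
    | some x => exact ⟨⟨x, hN.swap.girl_lt hM.swap hNy hy⟩, rfl⟩
  choose φ hφ using hX
  choose ψ hψ using hY
  have hφi : Function.Injective φ := fun x x' e => by
    have h1 := M.eq_some_iff.2 (hφ x)
    have h2 := M.eq_some_iff.2 (hφ x')
    rw [e, h2] at h1
    exact Subtype.ext (Option.some.inj h1).symm
  have hψi : Function.Injective ψ := fun y y' e => by
    have h1 := N.eq_some_iff.1 (hψ y)
    have h2 := N.eq_some_iff.1 (hψ y')
    rw [e, h2] at h1
    exact Subtype.ext (Option.some.inj h1).symm
  have hs : Function.Surjective (φ ∘ ψ) :=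
    Finite.surjective_of_injective (hφi.comp hψi)
  obtain ⟨y, hy⟩ := hs ⟨g, h⟩
  have h1 := hφ (ψ y)
  rw [show φ (ψ y) = ⟨g, h⟩ from hy] at h1
  have h2 := M.eq_some_iff.2 h1
  rw [M.eq_some_iff.2 hbg] at h2
  rw [Option.some.inj h2]
  exact (ψ y).2

/-- Every boy chooses the outcome that he prefers among those in `M` and `N`, and every girl the
one that she likes less. -/
def meet [Finite Girl] {A : SMInstance Boy Girl} {M N : Boy ≃. Girl} (hM : A.IsStable M)
    (hN : A.IsStable N) : Boy ≃. Girl where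
  toFun b := if prefRank (A.boyList b) (M b) ≤ prefRank (A.boyList b) (N b) then M b else N b
  invFun g := if prefRank (A.girlList g) (N.symm g) ≤ prefRank (A.girlList g) (M.symm g)
    then M.symm g else N.symm g
  inv b g := by
    constructor
    · intro h
      split_ifs at h with h1
      · have hb := M.eq_some_iff.1 h
        rcases h1.lt_or_eq with h2 | h2
        · rw [if_pos (hM.boy_lt hN hb h2).le, hb]
        · have h3 : N.symm g = M.symm g := hN.swap.eq_of_rank hM.swap h2
          rw [h] at h3
          have h4 := N.eq_some_iff.1 h3
          rw [hb, h4, ite_self]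
      · have hb := N.eq_some_iff.1 h
        rw [if_neg (not_le.2 (hN.boy_lt hM hb (not_le.1 h1))), hb]
    · intro h
      split_ifs at h with h1
      · have hg := M.eq_some_iff.2 h
        rcases h1.lt_or_eq with h2 | h2
        · rw [if_pos (hM.girl_lt hN h h2).le, hg]
        · have h3 : M b = N b := hM.eq_of_rank hN h2
          rw [h] at h3
          rw [hg, N.eq_some_iff.2 h3.symm, ite_self]
      · have hg := N.eq_some_iff.2 h
        rw [if_neg (not_le.2 (hN.girl_lt hM h (not_le.1 h1))), hg]

theorem isStable_meet [Finite Girl] {A : SMInstance Boy Girl} {M N : Boy ≃. Girl}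
    (hM : A.IsStable M) (hN : A.IsStable N) : A.IsStable (meet hM hN) := by
  refine ⟨fun b g h => ?_, fun b g hB => ?_⟩
  · change (if _ then M b else N b) = some g at h
    split_ifs at h with h1
    · exact hM.1 b g h
    · exact hN.1 b g h
  · obtain ⟨h1, h2, h3⟩ := hB
    change _ < prefRank _ (if _ then M b else N b) at h2
    change _ < prefRank _ (if _ then M.symm g else N.symm g) at h3
    split_ifs at h3 with h4
    · refine hM.2 b g ⟨h1, ?_, h3⟩
      split_ifs at h2 with h5
      · exact h2
      · exact h2.trans (not_le.1 h5)
    · refine hN.2 b g ⟨h1, ?_, h3⟩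
      split_ifs at h2 with h5
      · exact h2.trans_le h5
      · exact h2

/-- Every boy chooses the outcome that he likes less among those in `M` and `N`, and every girl the
one that she prefers. -/
def join [Finite Boy] {A : SMInstance Boy Girl} {M N : Boy ≃. Girl} (hM : A.IsStable M)
    (hN : A.IsStable N) : Boy ≃. Girl :=
  (meet hM.swap hN.swap).symm

theorem isStable_join [Finite Boy] {A : SMInstance Boy Girl} {M N : Boy ≃. Girl}
    (hM : A.IsStable M) (hN : A.IsStable N) : A.IsStable (join hM hN) :=
  (isStable_meet hM.swap hN.swap).swap

theorem meet_apply [Finite Girl] {A : SMInstance Boy Girl} {M N : Boy ≃. Girl}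
    (hM : A.IsStable M) (hN : A.IsStable N) (b : Boy) :
    meet hM hN b =
      if prefRank (A.boyList b) (M b) ≤ prefRank (A.boyList b) (N b) then M b else N b :=
  rfl

theorem join_apply [Finite Boy] {A : SMInstance Boy Girl} {M N : Boy ≃. Girl}
    (hM : A.IsStable M) (hN : A.IsStable N) (b : Boy) :
    join hM hN b =
      if prefRank (A.boyList b) (N b) ≤ prefRank (A.boyList b) (M b) then M b else N b :=
  rfl

end SMInstance

/-- The stable matchings of `A`. -/
structure StableMatching {Boy Girl : Type*} [DecidableEq Boy] [DecidableEq Girl]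
    (A : SMInstance Boy Girl) where
  matching : Boy ≃. Girl
  isStable : A.IsStable matching

namespace StableMatching

variable {Boy Girl : Type*} [DecidableEq Boy] [DecidableEq Girl] {A : SMInstance Boy Girl}

/-- Dominance: `M ≤ N` if every boy weakly prefers his outcome in `M` to his outcome in `N`. -/
instance : PartialOrder (StableMatching A) where
  le M N := ∀ b,
    prefRank (A.boyList b) (M.matching b) ≤ prefRank (A.boyList b) (N.matching b)
  le_refl _ _ := le_rfl
  le_trans _ _ _ h h' b := (h b).trans (h' b)
  le_antisymm := by
    rintro ⟨M, hM⟩ ⟨N, hN⟩ h h'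
    congr 1
    exact PEquiv.ext fun b => hM.eq_of_rank hN (le_antisymm (h b) (h' b))

theorem le_def {M N : StableMatching A} : M ≤ N ↔ ∀ b,
    prefRank (A.boyList b) (M.matching b) ≤ prefRank (A.boyList b) (N.matching b) :=
  Iff.rfl

/-- The lattice of stable matchings under dominance: in the meet each boy chooses his more
preferred outcome, in the join his less preferred one. -/
instance [Finite Boy] [Finite Girl] : Lattice (StableMatching A) where
  inf M N := ⟨SMInstance.meet M.isStable N.isStable, SMInstance.isStable_meet _ _⟩
  sup M N := ⟨SMInstance.join M.isStable N.isStable, SMInstance.isStable_join _ _⟩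
  inf_le_left M N b := by
    rw [SMInstance.meet_apply]; split_ifs with h
    · exact le_rfl
    · exact (not_le.1 h).le
  inf_le_right M N b := by
    rw [SMInstance.meet_apply]; split_ifs with h
    · exact h
    · exact le_rfl
  le_inf L M N h h' b := by
    rw [SMInstance.meet_apply]; split_ifs
    · exact h b
    · exact h' b
  le_sup_left M N b := by
    rw [SMInstance.join_apply]; split_ifs with h
    · exact le_rfl
    · exact (not_le.1 h).le
  le_sup_right M N b := by
    rw [SMInstance.join_apply]; split_ifs with h
    · exact h
    · exact le_rfl
  sup_le L M N h h' b := by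
    rw [SMInstance.join_apply]; split_ifs
    · exact h b
    · exact h' b

/-- The probability that `M` is stable for the instance drawn from `p`. -/
noncomputable def probStable (p : PMF A.ShiftDomain) (M : StableMatching A) : ENNReal :=
  p.toOuterMeasure {B | B.1.IsStable M.matching}

/-- `M` is robust: among the stable matchings of `A`, it has the highest probability of being
stable for the instance drawn from `p`. -/
def IsRobust (p : PMF A.ShiftDomain) (M : StableMatching A) : Prop :=
  ∀ N : StableMatching A, probStable p N ≤ probStable p M

end StableMatching

/-! The probability of stability is supermodular on the lattice: P(M) + P(N) ≤ P(M ⊓ N) + P(M ⊔ N).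
If M and N both maximize P, neither term on the right exceeds the maximum, so both attain it.
Supermodularity is checked for each shifted instance B separately: if M and N are both stable for B,
so are meet and join (`IsUpwardShift.isStable_meet_join`); if at least one is, then so is meet or
join (`IsUpwardShift.isStable_meet_or_join`). The second fact rests on `IsGirlShift.exists_blocks`:
a shift creates only one possible blocking pair. Shifts in a boy's list reduce to those in a girl's
list by exchanging the sexes. -/

/-- An upward shift of the entry `x` does not promote any other entry. -/
theorem prefRank_lt_of_shift {α : Type*} [DecidableEq α] {pre seg post : List α} {x a : α}
    (hax : a ≠ x) {y : Option α}
    (h : prefRank (pre ++ x :: seg ++ post) (some a) < prefRank (pre ++ x :: seg ++ post) y) :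
    prefRank (pre ++ seg ++ x :: post) (some a) < prefRank (pre ++ seg ++ x :: post) y := by
  -- `idxOf` returns the length for a missing entry, so this dichotomy decides every case of
  -- `List.idxOf_append`.
  have key : ∀ (l : List α) (c : α), (c ∈ l ∧ l.idxOf c < l.length) ∨
      (c ∉ l ∧ l.idxOf c = l.length) := fun l c => by
    by_cases hc : c ∈ l
    · exact Or.inl ⟨hc, List.idxOf_lt_length_of_mem hc⟩
    · exact Or.inr ⟨hc, List.idxOf_eq_length hc⟩
  have ha := key pre a
  have ha' := key seg a
  have ha'' := key post a
  rcases y with _ | y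
  · simp only [prefRank, List.idxOf_append, List.length_append, List.length_cons, List.mem_append,
      List.mem_cons, List.idxOf_cons_ne _ hax.symm, hax, false_or] at h ⊢
    split_ifs at h ⊢ <;> grind
  · have hy := key pre y
    have hy' := key seg y
    by_cases hyx : y = x
    · subst hyx
      simp only [prefRank, List.idxOf_append, List.length_append, List.mem_append,
        List.mem_cons, List.idxOf_cons_ne _ hax.symm, List.idxOf_cons_self, hax, false_or,
        true_or] at h ⊢
      split_ifs at h ⊢ <;> grind
    · simp only [prefRank, List.idxOf_append, List.length_append, List.length_cons,
        List.mem_append, List.mem_cons, List.idxOf_cons_ne _ hax.symm,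
        List.idxOf_cons_ne _ (Ne.symm hyx), hax, hyx, false_or] at h ⊢
      split_ifs at h ⊢ <;> grind

/-! ### Stability of meet and join under a single shift -/

namespace SMInstance

/-- `B` is obtained from `A` by an upward shift in the list of a single girl. -/
def IsGirlShift {Boy Girl : Type*} (A B : SMInstance Boy Girl) : Prop :=
  ∃ g, IsUpwardShiftOfList (A.girlList g) (B.girlList g) ∧
    (∀ g', g' ≠ g → B.girlList g' = A.girlList g') ∧ B.boyList = A.boyList

theorem IsGirlShift.boyList_eq {Boy Girl : Type*} {A B : SMInstance Boy Girl}
    (h : A.IsGirlShift B) : B.boyList = A.boyList := by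
  obtain ⟨_, _, _, h⟩ := h
  exact h

/-- Reduces the two kinds of shift to one; `swap` also exchanges meet and join. -/
theorem isUpwardShift_iff {Boy Girl : Type*} {A B : SMInstance Boy Girl} :
    A.IsUpwardShift B ↔ A.IsGirlShift B ∨ A.swap.IsGirlShift B.swap :=
  Iff.rfl

section

variable {Boy Girl : Type*} [DecidableEq Boy] [DecidableEq Girl] {A B : SMInstance Boy Girl}
  {M N : Boy ≃. Girl}

theorem isStable_swap_iff : A.swap.IsStable M.symm ↔ A.IsStable M :=
  ⟨fun h => h.swap, fun h => h.swap⟩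

/-- All stable matchings of `A` that a shift in a girl's list makes unstable are blocked by the
same pair. -/
theorem IsGirlShift.exists_blocks (h : A.IsGirlShift B) :
    ∃ b₀ g₀, ∀ M : Boy ≃. Girl, A.IsStable M → ∀ b g, B.Blocks M b g → b = b₀ ∧ g = g₀ := by
  obtain ⟨g₀, ⟨pre, seg, x, post, hA, hB⟩, hne, hboy⟩ := h
  -- Only the promoted boy `x` can gain on the situation of `g₀`; any other pair blocking in `B`
  -- would already block in `A`.
  refine ⟨x, g₀, fun M hM b g hbl => ?_⟩
  obtain ⟨h1, h2, h3⟩ := hbl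
  rw [hboy] at h1 h2
  by_cases hg : g = g₀
  · refine ⟨?_, hg⟩
    by_contra hb
    subst hg
    rw [hB] at h3
    refine hM.2 b g ⟨h1, h2, ?_⟩
    rw [hA]
    exact prefRank_lt_of_shift hb h3
  · rw [hne g hg] at h3
    exact absurd ⟨h1, h2, h3⟩ (hM.2 b g)

/-- A stable matching of `A` is unstable for a girl's shift only because of a blocking pair. -/
theorem IsGirlShift.isStable_iff (h : A.IsGirlShift B) (hM : A.IsStable M) :
    B.IsStable M ↔ ∀ b g, ¬ B.Blocks M b g :=
  ⟨fun h' => h'.2, fun h' => ⟨fun b g hbg => by rw [h.boyList_eq]; exact hM.1 b g hbg, h'⟩⟩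

theorem meet_symm_apply [Finite Girl] (hM : A.IsStable M) (hN : A.IsStable N) (g : Girl) :
    (meet hM hN).symm g =
      if prefRank (A.girlList g) (N.symm g) ≤ prefRank (A.girlList g) (M.symm g)
        then M.symm g else N.symm g :=
  rfl

theorem join_symm_apply [Finite Boy] (hM : A.IsStable M) (hN : A.IsStable N) (g : Girl) :
    (join hM hN).symm g =
      if prefRank (A.girlList g) (M.symm g) ≤ prefRank (A.girlList g) (N.symm g)
        then M.symm g else N.symm g :=
  rfl

theorem meet_swap [Finite Boy] (hM : A.IsStable M) (hN : A.IsStable N) :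
    meet hM.swap hN.swap = (join hM hN).symm :=
  rfl

theorem join_swap [Finite Girl] (hM : A.IsStable M) (hN : A.IsStable N) :
    join hM.swap hN.swap = (meet hM hN).symm :=
  rfl

variable [Finite Boy] [Finite Girl]

/-- The boys' choices determine the meet and the join, and the boys' lists agree in `A` and `B`; so
both operations coincide with those of `B`, which preserve stability for `B`. -/
theorem IsGirlShift.isStable_meet_join (h : A.IsGirlShift B) (hM : A.IsStable M)
    (hN : A.IsStable N) (hM' : B.IsStable M) (hN' : B.IsStable N) :
    B.IsStable (meet hM hN) ∧ B.IsStable (join hM hN) := by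
  have hmeet : meet hM hN = meet hM' hN' := PEquiv.ext fun b => by
    rw [meet_apply, meet_apply, h.boyList_eq]
  have hjoin : join hM hN = join hM' hN' := PEquiv.ext fun b => by
    rw [join_apply, join_apply, h.boyList_eq]
  rw [hmeet, hjoin]
  exact ⟨isStable_meet hM' hN', isStable_join hM' hN'⟩

/-- Were both unstable, the same pair would block both. Between them, meet and join give the girl
her outcomes in `M` and in `N`, and the meet gives the boy his better one, so the pair would block
`M` and `N` too. -/
theorem IsGirlShift.isStable_meet_or_join (h : A.IsGirlShift B) (hM : A.IsStable M)
    (hN : A.IsStable N) (h' : B.IsStable M ∨ B.IsStable N) :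
    B.IsStable (meet hM hN) ∨ B.IsStable (join hM hN) := by
  by_contra! hcon
  rw [h.isStable_iff (isStable_meet hM hN), h.isStable_iff (isStable_join hM hN)] at hcon
  push Not at hcon
  obtain ⟨⟨b, g, hmeet⟩, ⟨b', g', hjoin⟩⟩ := hcon
  obtain ⟨b₀, g₀, hu⟩ := h.exists_blocks
  obtain ⟨rfl, rfl⟩ := hu _ (isStable_meet hM hN) _ _ hmeet
  obtain ⟨rfl, rfl⟩ := hu _ (isStable_join hM hN) _ _ hjoin
  obtain ⟨h1, h2, h3⟩ := hmeet
  obtain ⟨-, -, h4⟩ := hjoin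
  rw [meet_apply, ← h.boyList_eq] at h2
  rw [meet_symm_apply] at h3
  rw [join_symm_apply] at h4
  have hgirl : prefRank (B.girlList g') (some b') < prefRank (B.girlList g') (M.symm g') ∧
      prefRank (B.girlList g') (some b') < prefRank (B.girlList g') (N.symm g') := by
    rcases lt_trichotomy (prefRank (A.girlList g') (M.symm g'))
      (prefRank (A.girlList g') (N.symm g')) with hlt | heq | hgt
    · rw [if_neg (not_le.2 hlt)] at h3
      rw [if_pos hlt.le] at h4
      exact ⟨h4, h3⟩
    -- On a tie both operations select `M.symm g'`, so the bound for `N` needs the two partners to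
    -- be equal.
    · have he : M.symm g' = N.symm g' := hM.swap.eq_of_rank hN.swap heq
      rw [if_pos heq.ge] at h3
      exact ⟨h3, he ▸ h3⟩
    · rw [if_pos hgt.le] at h3
      rw [if_neg (not_le.2 hgt)] at h4
      exact ⟨h3, h4⟩
  have hboy : prefRank (B.boyList b') (some g') < prefRank (B.boyList b') (M b') ∧
      prefRank (B.boyList b') (some g') < prefRank (B.boyList b') (N b') := by
    split_ifs at h2 with hle
    · exact ⟨h2, h2.trans_le hle⟩
    · exact ⟨h2.trans (not_le.1 hle), h2⟩
  rcases h' with h' | h'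
  · exact h'.2 b' g' ⟨h1, hboy.1, hgirl.1⟩
  · exact h'.2 b' g' ⟨h1, hboy.2, hgirl.2⟩

theorem IsUpwardShift.isStable_meet_join (h : A.IsUpwardShift B) (hM : A.IsStable M)
    (hN : A.IsStable N) (hM' : B.IsStable M) (hN' : B.IsStable N) :
    B.IsStable (meet hM hN) ∧ B.IsStable (join hM hN) := by
  rcases isUpwardShift_iff.1 h with h | h
  · exact h.isStable_meet_join hM hN hM' hN'
  · have := h.isStable_meet_join hM.swap hN.swap hM'.swap hN'.swap
    rw [meet_swap, join_swap, isStable_swap_iff, isStable_swap_iff] at this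
    exact this.symm

theorem IsUpwardShift.isStable_meet_or_join (h : A.IsUpwardShift B) (hM : A.IsStable M)
    (hN : A.IsStable N) (h' : B.IsStable M ∨ B.IsStable N) :
    B.IsStable (meet hM hN) ∨ B.IsStable (join hM hN) := by
  rcases isUpwardShift_iff.1 h with h | h
  · exact h.isStable_meet_or_join hM hN h'
  · have := h.isStable_meet_or_join hM.swap hN.swap (h'.imp IsStable.swap IsStable.swap)
    rw [meet_swap, join_swap, isStable_swap_iff, isStable_swap_iff] at this
    exact this.symm

end

end SMInstance

/-! ### Supermodularity and robustness -/

namespace StableMatching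

section

variable {Boy Girl : Type*} [DecidableEq Boy] [DecidableEq Girl] {A : SMInstance Boy Girl}

theorem probStable_ne_top (p : PMF A.ShiftDomain) (M : StableMatching A) :
    probStable p M ≠ ⊤ := by
  let _ : MeasurableSpace A.ShiftDomain := ⊤
  rw [probStable, ← p.toMeasure_apply_eq_toOuterMeasure_apply trivial]
  exact MeasureTheory.measure_ne_top _ _

/-- The probability of stability is a supermodular function on the lattice of stable matchings. -/
theorem probStable_add_le [Finite Boy] [Finite Girl] (p : PMF A.ShiftDomain)
    (M N : StableMatching A) :
    probStable p M + probStable p N ≤ probStable p (M ⊓ N) + probStable p (M ⊔ N) := by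
  let _ : MeasurableSpace A.ShiftDomain := ⊤
  simp only [probStable, ← p.toMeasure_apply_eq_toOuterMeasure_apply
    (show MeasurableSet (_ : Set A.ShiftDomain) from trivial)]
  have hm (s : Set A.ShiftDomain) : MeasurableSet s := trivial
  -- Each sum becomes the measure of a union plus that of an intersection; unions and intersections
  -- are then compared by inclusion.
  rw [← MeasureTheory.measure_union_add_inter {B | B.1.IsStable M.matching} (hm _),
    ← MeasureTheory.measure_union_add_inter {B | B.1.IsStable (M ⊓ N).matching} (hm _)]
  refine add_le_add (MeasureTheory.measure_mono fun B hB => ?_)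
    (MeasureTheory.measure_mono fun B hB => ?_)
  · exact B.2.isStable_meet_or_join M.isStable N.isStable hB
  · exact B.2.isStable_meet_join M.isStable N.isStable hB.1 hB.2

end

end StableMatching

theorem lemma4p3 {Boy Girl : Type*} [Finite Boy] [Finite Girl] [DecidableEq Boy]
    [DecidableEq Girl] (A : SMInstance Boy Girl) (p : PMF A.ShiftDomain) :
    IsSublattice {M : StableMatching A | StableMatching.IsRobust p M} := by
  refine ⟨fun M hM N hN L => (hM L).trans ?_, fun M hM N hN L => (hM L).trans ?_⟩
  -- Robustness of `N` bounds the meet's term by that of `N`, which cancels because it is finite.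
  · have h := (StableMatching.probStable_add_le p M N).trans (add_le_add_left (hN (M ⊓ N)) _)
    rw [add_comm] at h
    exact (ENNReal.add_le_add_iff_left (StableMatching.probStable_ne_top p N)).1 h
  · have h := (StableMatching.probStable_add_le p M N).trans (add_le_add_right (hN (M ⊔ N)) _)
    exact (ENNReal.add_le_add_iff_right (StableMatching.probStable_ne_top p N)).1 h
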